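/- Throughout, $\mathcal F_\emptyset$ is the set of finite subsets of $\mathbb N=\{0,1,2,\dots\}$, $\mathcal F=\mathcal F_\emptyset\setminus\{\emptyset\}$, and $\alpha<\beta$ means $\max\alpha<\min\beta$. A \emph{prefiltration} $G_\bullet$ is a sequence of nested groups $G_0\ge G_1\ge G_2\ge\cdots$ with $[G_i,G_j]\subset G_{i+j}$ for all $i,j\in\mathbb N$; it has \emph{finite length} if some $G_n$ is trivial. Write $G_{\bullet+1}$ for the prefiltration $i\mapsto G_{i+1}$. For a prefiltration of finite length, $G_\bullet$-\emph{polynomial} maps $g:\mathcal F_\emptyset\to G_0$ are defined recursively: $g$ is $G_\bullet$-polynomial if either $G_0$ is trivial, or for every $\alpha\in\mathcal F_\emptyset$ there is a $G_{\bullet+1}$-polynomial map $D_\alpha g$ with $D_\alpha g(\beta)=g(\beta)^{-1}g(\alpha\cup\beta)$ for all $\beta\in\mathcal F_\emptyset$ disjoint from $\alpha$. Let $\mathrm{VIP}(G_\bullet)$ be the group (under pointwise multiplication) of $G_\bullet$-polynomial maps $g$ with $g(\emptyset)=1$. A \emph{VIP group} is a subgroup $F\le \mathrm{VIP}(G_\bullet)$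 that is closed under conjugation by constant functions with values in $G_0$ and such that, for all $g\in F$ and $\alpha\in\mathcal F$, the symmetric derivative $\beta\mapsto g(\beta)^{-1}g(\alpha\cup\beta)g(\alpha)^{-1}$ (defined for $\beta$ disjoint from $\alpha$) agrees on its domain with an element of $F$ that is $G_{\bullet+1}$-polynomial. An \emph{FVIP group} is a finitely generated VIP group. A point $x$ of a topological space $X$ is an \emph{IP-limit} of a family $(x_\alpha)_{\alpha\in\mathcal F}$ in $X$ if for every neighbourhood $U$ of $x$ there is $\alpha_0\in\mathcal F$ such that $x_\alpha\in U$ for all $\alpha\in\mathcal F$ with $\alpha>\alpha_0$. \textbf{Theorem.} Let $G_\bullet$ be a prefiltration of finite length and let $F\le\mathrm{VIP}(G_\bullet)$ be an FVIP group. Suppose that $G_0$ acts on a (real or complex) Hilbert space $H$ by unitary operators and that for each $g\in F$ and each $f\in H$ the IP-limit $P_gf$ of $(g(\alpha)f)_{\alpha\in\mathcal F}$ in the weak topology of $H$ exists. Then each $P_g$, $g\in F$, is an orthogonal projection (onto a closed subspace of $H$), and these projections commute pairwise: $P_gP_h=P_hP_g$ for all $g,h\in F$. -/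

import Mathlib

open Topology

namespace FVIP

/-- A prefiltration: nested subgroups `G 0 ≥ G 1 ≥ ...` with `[G i, G j] ≤ G (i + j)`. -/
structure Prefiltration (Γ : Type*) [Group Γ] where
  grp : ℕ → Subgroup Γ
  antitone' : Antitone grp
  commutator_le' : ∀ i j, ⁅grp i, grp j⁆ ≤ grp (i + j)

namespace Prefiltration

variable {Γ : Type*} [Group Γ]

/-- The shifted prefiltration `G[+1]`, given by `i ↦ G (i + 1)`. -/
def shift (G : Prefiltration Γ) : Prefiltration Γ where
  grp i := G.grp (i + 1)
  antitone' _ _ h := G.antitone' (Nat.succ_le_succ h)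
  commutator_le' i j := (G.commutator_le' (i + 1) (j + 1)).trans (G.antitone' (by omega))

/-- A prefiltration has finite length if it reaches the trivial group. -/
def HasFiniteLength (G : Prefiltration Γ) : Prop := ∃ n, G.grp n = ⊥

/-- `G`-polynomial maps on the finite subsets of `ℕ`: either `G 0` is trivial (and `g` is
identically `1`), or `g` takes values in `G 0` and for each finite set `α` the discrete derivative
`β ↦ (g β)⁻¹ * g (α ∪ β)`, which is defined for `β` disjoint from `α`, agrees on its domain with a
`G[+1]`-polynomial map `D α`. -/
inductive IsPolynomial : Prefiltration Γ → (Finset ℕ → Γ) → Prop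
  | trivial (G : Prefiltration Γ) (g : Finset ℕ → Γ)
      (hG : G.grp 0 = ⊥) (hg : ∀ α, g α = 1) : IsPolynomial G g
  | step (G : Prefiltration Γ) (g : Finset ℕ → Γ) (D : Finset ℕ → Finset ℕ → Γ)
      (hg : ∀ α, g α ∈ G.grp 0)
      (hD : ∀ α, IsPolynomial G.shift (D α))
      (hDg : ∀ α β, Disjoint α β → D α β = (g β)⁻¹ * g (α ∪ β)) : IsPolynomial G g

/-- VIP systems: polynomial maps that are trivial at the empty set. -/
def IsVIP (G : Prefiltration Γ) (g : Finset ℕ → Γ) : Prop :=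
  G.IsPolynomial g ∧ g ∅ = 1

/-- A VIP group is a group `F` of VIP systems, closed under conjugation by constant functions
with values in `G 0`, and such that for each `g ∈ F` and each nonempty `α` the symmetric derivative
`β ↦ (g β)⁻¹ * g (α ∪ β) * (g α)⁻¹`, defined for `β` disjoint from `α`, is given by an element
of `F 1`, that is, by a `G[+1]`-polynomial element of `F`. -/
structure IsVIPGroup (G : Prefiltration Γ) (F : Subgroup (Finset ℕ → Γ)) : Prop where
  isVIP : ∀ g ∈ F, G.IsVIP g
  conj_mem : ∀ g ∈ F, ∀ c ∈ G.grp 0, (fun α => c⁻¹ * g α * c) ∈ F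
  symmDeriv_mem : ∀ g ∈ F, ∀ α : Finset ℕ, α.Nonempty →
    ∃ h ∈ F, G.shift.IsPolynomial h ∧
      ∀ β, Disjoint α β → h β = (g β)⁻¹ * g (α ∪ β) * (g α)⁻¹

/-- An FVIP group is a finitely generated VIP group. -/
def IsFVIPGroup (G : Prefiltration Γ) (F : Subgroup (Finset ℕ → Γ)) : Prop :=
  G.IsVIPGroup F ∧ F.FG

end Prefiltration

/-- The order on finite sets: `α < β` iff `max α < min β`. -/
def Precedes (α β : Finset ℕ) : Prop := ∀ i ∈ α, ∀ j ∈ β, i < j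

/-- `x` is an IP-limit of the family `u`, indexed by the nonempty finite subsets of `ℕ` (the value
of `u` at the empty set is irrelevant). -/
def IsIPLimit {X : Type*} [TopologicalSpace X] (u : Finset ℕ → X) (x : X) : Prop :=
  ∀ U ∈ 𝓝 x, ∃ α₀ : Finset ℕ, α₀.Nonempty ∧
    ∀ α : Finset ℕ, α.Nonempty → Precedes α₀ α → u α ∈ U

/-- IP-limits in the weak topology of a Hilbert space. -/
def IsWeakIPLimit (𝕜 : Type*) {H : Type*} [RCLike 𝕜] [NormedAddCommGroup H]
    [InnerProductSpace 𝕜 H] (u : Finset ℕ → H) (x : H) : Prop :=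
  IsIPLimit (fun α => toWeakSpace 𝕜 H (u α)) (toWeakSpace 𝕜 H x)

/-- `P` is the orthogonal projection of `H` onto a subspace that admits one
(for complete `H`: a closed subspace). -/
def IsOrthogonalProjection (𝕜 : Type*) {H : Type*} [RCLike 𝕜] [NormedAddCommGroup H]
    [InnerProductSpace 𝕜 H] (P : H → H) : Prop :=
  ∃ (K : Submodule 𝕜 H) (_ : K.HasOrthogonalProjection), ∀ f, P f = K.starProjection f

end FVIP

/-!
Write `P g` for the weak IP-limit of `g ∈ F`, and let `F i` be the subgroup of those elements of
`F` that eventually agree with a `G[+i]`-polynomial map. Polynomial maps form groups whose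
commutators add the levels (`IsPolynomialAt.group_and_commutator`), so derivatives of elements of
`F i`, and commutators of elements of `F i` with values of elements of `F`, belong to `F (i + 1)`.
The elements of `F d` are eventually trivial as soon as `G d` is. By downward induction on `m`, the
limits `P g`, `g ∈ F m`, are commuting projections.

Suppose this is known for `K = F (m + 1)`. Since `F` is finitely generated and nilpotent, it
satisfies the maximal condition on subgroups
(`wellFoundedGT_subgroup_of_lowerCentralSeries_eq_bot`). Hence the Hilbert space is the closed span
of joint eigenspaces: each is attached to a subgroup `L`, and there `P l` is the identity for `l ∈
K ∩ L` and zero for `l ∈ K \ L` (`HasWeakIPLimits.topologicalClosure_iSup_jointEigenspace`). For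
`f` in such a space and `g ∈ F m` write `g (α ∪ β) = g α * g β * h β α` with `h β ∈ K`. If `h β ∈
L` for arbitrarily late `β`, letting `α` and then `β` tend to infinity gives `P g f = P g (P g f)`;
otherwise `h β` is eventually outside `L` and the van der Corput lemma gives `P g f = 0`
(`HasWeakIPLimits.idem_of_mem_jointEigenspace`). An idempotent `P g` is an orthogonal projection,
because its adjoint is `P g⁻¹`, which fixes the range of `P g`.

For commutation, let `g ∈ F m` and `k ∈ F i` with `i ≥ m`, and assume by a second downward
induction, on `i`, that all `P a`, `a ∈ F m`, commute with `P l` for `l ∈ F (i + 1)`. It suffices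
that `P k` preserves the range of `P g`, and this may be tested on vectors `f = P g f` in a joint
eigenspace of `F (i + 1)` with subgroup `L`. Now `P k (g β f) = g β (P (k * e β) f)` with
commutators `e β ∈ F (i + 1)`, and the left side tends to `P k f` along the sets `β = {n}`. If some
coset of `L` contains `e {n}` for infinitely many `n`, then `P (k * e {n}) f` is a constant `v`
along these `n` and `P k f = P g v`. Otherwise infinitely many of the vectors `P (k * e {n}) f` are
pairwise orthogonal, and `P k f = 0` (`HasWeakIPLimits.apply_apply_of_mem_jointEigenspace`).
-/

open Topology Filter
open scoped commutatorElement InnerProductSpace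

namespace FVIP

/-! ### The group of polynomial maps -/

namespace Prefiltration

variable {Γ : Type*} [Group Γ] (G : Prefiltration Γ)

/-- Polynomial maps for the `i`-fold shift `G[+i]`. -/
def IsPolynomialAt (i : ℕ) (g : Finset ℕ → Γ) : Prop := (shift^[i] G).IsPolynomial g

theorem shift_iterate_grp (i n : ℕ) : (shift^[i] G).grp n = G.grp (n + i) := by
  induction i generalizing n with
  | zero => rfl
  | succ i ih =>
    rw [Function.iterate_succ_apply']
    exact (ih (n + 1)).trans (by congr 1; omega)

theorem isPolynomial_iff (g : Finset ℕ → Γ) :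
    G.IsPolynomial g ↔ (∀ α, g α ∈ G.grp 0) ∧ ∀ α, ∃ D, G.shift.IsPolynomial D ∧
      ∀ β, Disjoint α β → g (α ∪ β) = g β * D β := by
  constructor
  · rintro (⟨_, _, hG, hg⟩ | ⟨_, _, D, hg, hD, hDg⟩)
    · refine ⟨fun α => by simp [hg], fun α => ⟨1, .trivial _ _ ?_ fun _ => rfl, fun β _ => ?_⟩⟩
      · exact le_bot_iff.1 ((G.antitone' (Nat.zero_le 1)).trans hG.le)
      · simp [hg]
    · exact ⟨hg, fun α => ⟨D α, hD α, fun β h => by rw [hDg α β h, mul_inv_cancel_left]⟩⟩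
  · rintro ⟨hg, h⟩
    choose D hD hDg using h
    exact .step _ _ D hg hD fun α β h => by rw [hDg α β h, inv_mul_cancel_left]

namespace IsPolynomialAt

variable {G}

theorem iff_exists_deriv {i : ℕ} {g : Finset ℕ → Γ} :
    G.IsPolynomialAt i g ↔ (∀ α, g α ∈ G.grp i) ∧ ∀ α, ∃ D, G.IsPolynomialAt (i + 1) D ∧
      ∀ β, Disjoint α β → g (α ∪ β) = g β * D β := by
  unfold IsPolynomialAt
  rw [isPolynomial_iff, shift_iterate_grp, Function.iterate_succ_apply', zero_add]

theorem mem_grp {i : ℕ} {g : Finset ℕ → Γ} (h : G.IsPolynomialAt i g) (α : Finset ℕ) :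
    g α ∈ G.grp i := (iff_exists_deriv.1 h).1 α

theorem mem_grp_succ {i : ℕ} {g : Finset ℕ → Γ} (hg : G.IsPolynomialAt i g)
    (h0 : g ∅ = 1) (α : Finset ℕ) :
    g α ∈ G.grp (i + 1) := by
  obtain ⟨D, hD, hDg⟩ := (iff_exists_deriv.1 hg).2 α
  have h := hDg ∅ (Finset.disjoint_empty_right α)
  rw [h0, one_mul, Finset.union_empty] at h
  rw [h]
  exact hD.mem_grp ∅

variable {d : ℕ} (hd : G.grp d = ⊥)
include hd

theorem eq_one_of_le {i : ℕ} (hi : d ≤ i) {g : Finset ℕ → Γ} (h : G.IsPolynomialAt i g) :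
    g = 1 := by
  funext α
  have := G.antitone' hi (h.mem_grp α)
  rwa [hd, Subgroup.mem_bot] at this

theorem one (i : ℕ) : G.IsPolynomialAt i 1 := by
  have main : ∀ n i, d ≤ i + n → G.IsPolynomialAt i 1 := by
    intro n
    induction n with
    | zero =>
      intro i hi
      refine .trivial _ _ ?_ fun _ => rfl
      rw [shift_iterate_grp]
      exact le_bot_iff.1 ((G.antitone' (by omega)).trans hd.le)
    | succ n ih =>
      intro i hi
      exact iff_exists_deriv.2 ⟨fun _ => one_mem _, fun α => ⟨1, ih _ (by omega), by simp⟩⟩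
  exact main d i (by omega)

theorem const {i : ℕ} {c : Γ} (hc : c ∈ G.grp i) : G.IsPolynomialAt i fun _ => c :=
  iff_exists_deriv.2 ⟨fun _ => hc, fun _ => ⟨1, one hd _, by simp⟩⟩

theorem of_succ {i : ℕ} {g : Finset ℕ → Γ} (h : G.IsPolynomialAt (i + 1) g) :
    G.IsPolynomialAt i g := by
  have main : ∀ n i, d ≤ i + n → ∀ g, G.IsPolynomialAt (i + 1) g → G.IsPolynomialAt i g := by
    intro n
    induction n with
    | zero =>
      intro i hi g h
      rw [eq_one_of_le hd (by omega) h]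
      exact one hd i
    | succ n ih =>
      intro i hi g h
      refine iff_exists_deriv.2 ⟨fun α => G.antitone' (Nat.le_succ i) (h.mem_grp α), fun α => ?_⟩
      obtain ⟨D, hD, hDg⟩ := (iff_exists_deriv.1 h).2 α
      exact ⟨D, ih _ (by omega) _ hD, hDg⟩
  exact main d i (by omega) g h

theorem mono {i j : ℕ} (hij : i ≤ j) {g : Finset ℕ → Γ} (h : G.IsPolynomialAt j g) :
    G.IsPolynomialAt i g := by
  induction hij with
  | refl => exact h
  | step _ ih => exact ih (of_succ hd h)

/-- Polynomial maps of the shifts of `G` form groups whose commutators add the shifts. The induction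
runs downwards from the length of `G`. Given the result above level `i`, one first shows that the
maps of level `i` normalize those of every level `m > i`; this yields inverses and products at
level `i`, and finally commutators with a factor of level `i`. -/
theorem group_and_commutator (i : ℕ) :
    (∀ a, i ≤ a → (∀ g h, G.IsPolynomialAt a g → G.IsPolynomialAt a h →
        G.IsPolynomialAt a (g * h)) ∧ ∀ g, G.IsPolynomialAt a g → G.IsPolynomialAt a g⁻¹) ∧
      ∀ a b, i ≤ a → i ≤ b → ∀ g h, G.IsPolynomialAt a g → G.IsPolynomialAt b h →
        G.IsPolynomialAt (a + b) ⁅g, h⁆ := by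
  by_cases hid : d ≤ i
  · refine ⟨fun a ha => ⟨fun g h hg hh => ?_, fun g hg => ?_⟩, fun a b ha hb g h hg hh => ?_⟩
    · rw [eq_one_of_le hd (hid.trans ha) hg, one_mul]; exact hh
    · rw [eq_one_of_le hd (hid.trans ha) hg, inv_one]; exact one hd _
    · rw [eq_one_of_le hd (hid.trans ha) hg, commutatorElement_one_left]; exact one hd _
  obtain ⟨hA, hB⟩ := group_and_commutator (i + 1)
  have mulA : ∀ {a g h}, i + 1 ≤ a → G.IsPolynomialAt a g → G.IsPolynomialAt a h →
    G.IsPolynomialAt a (g * h) := fun ha => (hA _ ha).1 _ _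
  have invA : ∀ {a g}, i + 1 ≤ a → G.IsPolynomialAt a g → G.IsPolynomialAt a g⁻¹ :=
    fun ha => (hA _ ha).2 _
  -- maps of level `i` normalize the maps of level `m > i`
  have hN : ∀ n m, d ≤ m + n → i + 1 ≤ m → ∀ g q, G.IsPolynomialAt i g → G.IsPolynomialAt m q →
      G.IsPolynomialAt m (g * q * g⁻¹) := by
    intro n
    induction n with
    | zero =>
      intro m hm _ g q _ hq
      rw [eq_one_of_le hd (by omega) hq, mul_one, mul_inv_cancel]; exact one hd _
    | succ n ih =>
      intro m hm him g q hg hq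
      refine iff_exists_deriv.2 ⟨fun α => ?_, fun α => ?_⟩
      · have h1 := G.commutator_le' i m
          (Subgroup.commutator_mem_commutator (hg.mem_grp α) (hq.mem_grp α))
        have h2 := mul_mem (G.antitone' (Nat.le_add_left m i) h1) (hq.mem_grp α)
        simpa [commutatorElement_def] using h2
      · obtain ⟨x, hx, hxg⟩ := (iff_exists_deriv.1 hg).2 α
        obtain ⟨y, hy, hyq⟩ := (iff_exists_deriv.1 hq).2 α
        refine ⟨g * (⁅q⁻¹, x⁆ * (⁅x, y⁆ * y)) * g⁻¹, ih (m + 1) (by omega) (by omega) g _ hg ?_,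
          fun β hβ => ?_⟩
        · refine mulA (by omega) (mono hd (by omega) (hB _ _ him le_rfl _ _ (invA him hq) hx)) ?_
          exact mulA (by omega) (mono hd (by omega) (hB _ _ le_rfl (by omega) _ _ hx hy)) hy
        · simp only [Pi.mul_apply, Pi.inv_apply, hxg β hβ, hyq β hβ, commutatorElement_def]
          group
  replace hN : ∀ {m g q}, i + 1 ≤ m → G.IsPolynomialAt i g → G.IsPolynomialAt m q →
      G.IsPolynomialAt m (g * q * g⁻¹) := fun {m g q} him => hN d m (by omega) him g q
  have hinv : ∀ g, G.IsPolynomialAt i g → G.IsPolynomialAt i g⁻¹ := by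
    intro g hg
    refine iff_exists_deriv.2 ⟨fun α => inv_mem (hg.mem_grp α), fun α => ?_⟩
    obtain ⟨x, hx, hxg⟩ := (iff_exists_deriv.1 hg).2 α
    refine ⟨g * x⁻¹ * g⁻¹, hN le_rfl hg (invA le_rfl hx), fun β hβ => ?_⟩
    simp only [Pi.mul_apply, Pi.inv_apply, hxg β hβ]
    group
  have hmul : ∀ g h, G.IsPolynomialAt i g → G.IsPolynomialAt i h →
      G.IsPolynomialAt i (g * h) := by
    intro g h hg hh
    refine iff_exists_deriv.2 ⟨fun α => mul_mem (hg.mem_grp α) (hh.mem_grp α), fun α => ?_⟩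
    obtain ⟨x, hx, hxg⟩ := (iff_exists_deriv.1 hg).2 α
    obtain ⟨y, hy, hyh⟩ := (iff_exists_deriv.1 hh).2 α
    refine ⟨h⁻¹ * x * h⁻¹⁻¹ * y, mulA le_rfl (hN le_rfl (hinv h hh) hx) hy, fun β hβ => ?_⟩
    simp only [Pi.mul_apply, Pi.inv_apply, hxg β hβ, hyh β hβ]
    group
  have hA' : ∀ a, i ≤ a → (∀ g h, G.IsPolynomialAt a g → G.IsPolynomialAt a h →
      G.IsPolynomialAt a (g * h)) ∧ ∀ g, G.IsPolynomialAt a g → G.IsPolynomialAt a g⁻¹ := by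
    intro a ha
    rcases ha.eq_or_lt with rfl | ha
    · exact ⟨hmul, hinv⟩
    · exact hA a ha
  have hcomm : ∀ n b, d ≤ b + n → i ≤ b → ∀ g h, G.IsPolynomialAt i g → G.IsPolynomialAt b h →
      G.IsPolynomialAt (i + b) ⁅g, h⁆ := by
    intro n
    induction n with
    | zero =>
      intro b hb _ g h _ hh
      rw [eq_one_of_le hd (by omega) hh, commutatorElement_one_right]; exact one hd _
    | succ n ih =>
      intro b hb hib g h hg hh
      refine iff_exists_deriv.2 ⟨fun α => G.commutator_le' i b
        (Subgroup.commutator_mem_commutator (hg.mem_grp α) (hh.mem_grp α)), fun α => ?_⟩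
      obtain ⟨x, hx, hxg⟩ := (iff_exists_deriv.1 hg).2 α
      obtain ⟨y, hy, hyh⟩ := (iff_exists_deriv.1 hh).2 α
      have hh' : G.IsPolynomialAt i h := mono hd hib hh
      have hxh : G.IsPolynomialAt (i + b + 1) ⁅x, h⁆ := by
        rcases hib.eq_or_lt with rfl | hib'
        · rw [← commutatorElement_inv]
          exact invA (by omega)
            (by simpa [add_assoc] using ih (i + 1) (by omega) (by omega) h x hh hx)
        · simpa [add_assoc, add_comm, add_left_comm] using hB _ _ le_rfl hib' _ _ hx hh
      have hxy : G.IsPolynomialAt (i + b + 1) ⁅x, y⁆ :=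
        mono hd (by omega) (hB _ _ le_rfl (by omega) _ _ hx hy)
      have hgy : G.IsPolynomialAt (i + b + 1) ⁅g, y⁆ := by
        simpa [add_assoc] using ih (b + 1) (by omega) (by omega) g y hg hy
      have hc : G.IsPolynomialAt i ⁅g, h⁆ := by
        rw [commutatorElement_def]
        exact hmul _ _ (hmul _ _ (hmul _ _ hg hh') (hinv _ hg)) (hinv _ hh')
      refine ⟨⁅g, h⁆⁻¹ * (g * (⁅x, h⁆ * (h * ⁅x, y⁆ * h⁻¹)) * g⁻¹) * ⁅g, h⁆⁻¹⁻¹ *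
        (h * ⁅g, y⁆ * h⁻¹), ?_, fun β hβ => ?_⟩
      · have hle : i + 1 ≤ i + b + 1 := by omega
        exact mulA hle (hN hle (hinv _ hc) (hN hle hg (mulA hle hxh (hN hle hh' hxy))))
          (hN hle hh' hgy)
      · simp only [Pi.mul_apply, Pi.inv_apply, hxg β hβ, hyh β hβ, commutatorElement_def]
        group
  refine ⟨hA', fun a b ha hb g h hg hh => ?_⟩
  rcases ha.eq_or_lt with rfl | ha
  · exact hcomm d b (by omega) hb g h hg hh
  rcases hb.eq_or_lt with rfl | hb
  · rw [← commutatorElement_inv, add_comm]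
    exact invA (by omega) (hcomm d a (by omega) ha.le h g hh hg)
  · exact hB a b ha hb g h hg hh
termination_by d - i

theorem mul {i : ℕ} {g h : Finset ℕ → Γ} (hg : G.IsPolynomialAt i g)
    (hh : G.IsPolynomialAt i h) : G.IsPolynomialAt i (g * h) :=
  ((group_and_commutator hd i).1 i le_rfl).1 g h hg hh

theorem inv {i : ℕ} {g : Finset ℕ → Γ} (hg : G.IsPolynomialAt i g) : G.IsPolynomialAt i g⁻¹ :=
  ((group_and_commutator hd i).1 i le_rfl).2 g hg

theorem commutator {i j : ℕ} {g h : Finset ℕ → Γ} (hg : G.IsPolynomialAt i g)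
    (hh : G.IsPolynomialAt j h) : G.IsPolynomialAt (i + j) ⁅g, h⁆ :=
  (group_and_commutator hd 0).2 i j (Nat.zero_le _) (Nat.zero_le _) g h hg hh

end IsPolynomialAt

end Prefiltration

/-! ### The maximal condition for finitely generated nilpotent groups -/

theorem wellFoundedGT_subgroup_of_normal {A : Type*} [Group A] (N : Subgroup A) [N.Normal]
    [WellFoundedGT (Subgroup N)] [WellFoundedGT (Subgroup (A ⧸ N))] :
    WellFoundedGT (Subgroup A) :=
  (QuotientGroup.strictMono_comap_prod_map N).wellFoundedGT

theorem fg_of_wellFoundedGT_subgroup {A : Type*} [Group A] [WellFoundedGT (Subgroup A)]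
    (K : Subgroup A) : K.FG := by
  obtain ⟨M, ⟨hM, hMK⟩, hmax⟩ := WellFounded.has_min
    (wellFounded_gt (α := Subgroup A)) {M | M.FG ∧ M ≤ K} ⟨⊥, Subgroup.FG.bot, bot_le⟩
  suffices K ≤ M from le_antisymm hMK this ▸ hM
  intro x hx
  have hx' : Subgroup.zpowers x ≤ K := by simpa using hx
  have h := hmax (M ⊔ Subgroup.zpowers x)
    ⟨hM.sup ⟨{x}, by simp [Subgroup.zpowers_eq_closure]⟩, sup_le hMK hx'⟩
  have h' : M ⊔ Subgroup.zpowers x = M :=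
    ((le_sup_left : M ≤ M ⊔ Subgroup.zpowers x).eq_or_lt.resolve_right h).symm
  rw [← h']
  exact Subgroup.mem_sup_right (Subgroup.mem_zpowers x)

theorem wellFoundedGT_subgroup_of_commGroup (A : Type*) [CommGroup A] [hA : Group.FG A] :
    WellFoundedGT (Subgroup A) := by
  have : Module.Finite ℤ (Additive A) :=
    Module.Finite.iff_addGroup_fg.2 (GroupFG.iff_add_fg.1 hA)
  have h : WellFoundedGT (Submodule ℤ (Additive A)) := inferInstance
  let e : Subgroup A ≃o Submodule ℤ (Additive A) :=
    Subgroup.toAddSubgroup.trans AddSubgroup.toIntSubmodule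
  exact e.strictMono.wellFoundedGT

/-- If `⁅K, ⊤⁆` is central, `K` is finitely generated modulo a central subgroup and `A` is finitely
generated, then `⁅K, ⊤⁆` is finitely generated, because the commutator is multiplicative in each
of its arguments. -/
theorem fg_commutator_top_of_le_center {A : Type*} [Group A] [hA : Group.FG A] (K N : Subgroup A)
    [N.Normal] (hN : N ≤ Subgroup.center A) (hKN : ⁅K, (⊤ : Subgroup A)⁆ ≤ N)
    (hK : (K.map (QuotientGroup.mk' N)).FG) : (⁅K, (⊤ : Subgroup A)⁆).FG := by
  classical
  obtain ⟨S, hS⟩ := hA.out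
  obtain ⟨T', hT'⟩ := hK
  have hsub : (T' : Set (A ⧸ N)) ⊆ QuotientGroup.mk' N '' (K : Set A) := by
    rw [← Subgroup.coe_map, ← hT']
    exact Subgroup.subset_closure
  obtain ⟨T, hTK, rfl⟩ := Finset.subset_set_image_iff.1 hsub
  have hcen : ∀ x ∈ K, ∀ y w : A, w * ⁅x, y⁆ = ⁅x, y⁆ * w := fun x hx y w =>
    Subgroup.mem_center_iff.1 (hN (hKN (Subgroup.commutator_mem_commutator hx trivial))) w
  set C : Subgroup A := Subgroup.closure (Set.image2 (fun t s => ⁅t, s⁆) (T : Set A) (S : Set A))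
    with hC
  have mul_right : ∀ x ∈ K, ∀ y z : A, ⁅x, y * z⁆ = ⁅x, y⁆ * ⁅x, z⁆ := by
    intro x hx y z
    have h1 : ⁅x, y * z⁆ = ⁅x, y⁆ * (y * ⁅x, z⁆) * y⁻¹ := by
      simp only [commutatorElement_def]; group
    rw [h1, hcen x hx z y]; group
  have mul_left : ∀ x : A, ∀ x' ∈ K, ∀ y : A, ⁅x * x', y⁆ = ⁅x', y⁆ * ⁅x, y⁆ := by
    intro x x' hx' y
    have h1 : ⁅x * x', y⁆ = x * ⁅x', y⁆ * x⁻¹ * ⁅x, y⁆ := by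
      simp only [commutatorElement_def]; group
    rw [h1, hcen x' hx' y x]; group
  have hTS : ∀ t ∈ T, ∀ y : A, ⁅t, y⁆ ∈ C := by
    intro t ht y
    have hy : y ∈ Subgroup.closure (S : Set A) := hS ▸ Subgroup.mem_top y
    induction hy using Subgroup.closure_induction with
    | mem s hs => exact Subgroup.subset_closure ⟨t, ht, s, hs, rfl⟩
    | one => rw [commutatorElement_one_right]; exact one_mem _
    | mul a b _ _ ha hb => rw [mul_right t (hTK ht)]; exact mul_mem ha hb
    | inv a _ ha =>
      have h := mul_right t (hTK ht) a a⁻¹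
      rw [mul_inv_cancel, commutatorElement_one_right] at h
      rw [eq_inv_of_mul_eq_one_right h.symm]
      exact inv_mem ha
  have hTC : ∀ x ∈ Subgroup.closure (T : Set A), x ∈ K ∧ ∀ y : A, ⁅x, y⁆ ∈ C := by
    intro x hx
    induction hx using Subgroup.closure_induction with
    | mem t ht => exact ⟨hTK ht, hTS t ht⟩
    | one => exact ⟨one_mem _, fun y => by rw [commutatorElement_one_left]; exact one_mem _⟩
    | mul a b _ _ ha hb =>
      exact ⟨mul_mem ha.1 hb.1, fun y => by
        rw [mul_left a b hb.1]; exact mul_mem (hb.2 y) (ha.2 y)⟩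
    | inv a _ ha =>
      refine ⟨inv_mem ha.1, fun y => ?_⟩
      have h := mul_left a a⁻¹ (inv_mem ha.1) y
      rw [mul_inv_cancel, commutatorElement_one_left] at h
      rw [eq_inv_of_mul_eq_one_left h.symm]
      exact inv_mem (ha.2 y)
  suffices h : ⁅K, (⊤ : Subgroup A)⁆ = C by
    rw [h, Subgroup.fg_iff]
    exact ⟨_, rfl, T.finite_toSet.image2 _ S.finite_toSet⟩
  apply le_antisymm
  · refine Subgroup.commutator_le.2 fun x hx y _ => ?_
    have hx' : QuotientGroup.mk' N x ∈
        (Subgroup.closure (T : Set A)).map (QuotientGroup.mk' N) := by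
      rw [MonoidHom.map_closure, ← Finset.coe_image, hT']
      exact Subgroup.mem_map_of_mem _ hx
    obtain ⟨c, hc, hcx⟩ := hx'
    have hz : c⁻¹ * x ∈ Subgroup.center A := hN (QuotientGroup.eq.1 hcx)
    obtain ⟨z, rfl⟩ : ∃ z, x = c * z := ⟨c⁻¹ * x, by group⟩
    rw [inv_mul_cancel_left] at hz
    have h1 : ⁅c * z, y⁆ = ⁅c, y⁆ := by
      have h2 : ⁅c * z, y⁆ = c * (z * y) * z⁻¹ * c⁻¹ * y⁻¹ := by
        simp only [commutatorElement_def]; group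
      rw [h2, ← Subgroup.mem_center_iff.1 hz y, commutatorElement_def]; group
    rw [h1]
    exact (hTC c hc).2 y
  · rw [hC, Subgroup.closure_le]
    rintro _ ⟨t, ht, s, _, rfl⟩
    exact Subgroup.commutator_mem_commutator (hTK ht) trivial

/-- Finitely generated nilpotent groups satisfy the maximal condition on subgroups, by induction on
the nilpotency class: the last nontrivial term of the lower central series is central and finitely
generated. -/
theorem wellFoundedGT_subgroup_of_lowerCentralSeries_eq_bot (n : ℕ) (A : Type*) [Group A]
    [Group.FG A] (hn : (⊤ : Subgroup A).lowerCentralSeries n = ⊥) :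
    WellFoundedGT (Subgroup A) := by
  induction n generalizing A with
  | zero =>
    have : Subsingleton (Subgroup A) := subsingleton_of_bot_eq_top hn.symm
    infer_instance
  | succ n ih =>
    set N := (⊤ : Subgroup A).lowerCentralSeries n with hNdef
    have hN : N ≤ Subgroup.center A := by
      intro x hx
      refine Subgroup.mem_center_iff.2 fun y => ?_
      have h : ⁅x, y⁆ ∈ (⊤ : Subgroup A).lowerCentralSeries (n + 1) :=
        Subgroup.commutator_mem_commutator hx trivial
      rw [hn, Subgroup.mem_bot, commutatorElement_eq_one_iff_mul_comm] at h
      exact h.symm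
    have hQ : WellFoundedGT (Subgroup (A ⧸ N)) := by
      refine ih (A ⧸ N) ?_
      rw [← Subgroup.map_top_of_surjective _ (QuotientGroup.mk'_surjective N),
        ← Subgroup.map_lowerCentralSeries, ← hNdef]
      exact QuotientGroup.map_mk'_self N
    have hNfg : N.FG := by
      cases n with
      | zero => exact Group.FG.out
      | succ m =>
        exact fg_commutator_top_of_le_center _ N hN le_rfl (fg_of_wellFoundedGT_subgroup _)
    have : Group.FG N := (Group.fg_iff_subgroup_fg N).2 hNfg
    let _ : CommGroup N :=
      { (inferInstance : Group N) with
        mul_comm := fun x y => Subtype.ext (Subgroup.mem_center_iff.1 (hN y.2) x) }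
    have := wellFoundedGT_subgroup_of_commGroup N
    exact wellFoundedGT_subgroup_of_normal N

/-! ### IP-limits as limits along a filter -/

/-- The filter of IP-convergence on the finite subsets of `ℕ`: a set is large if it contains every
nonempty `α` whose elements are all at least `n`, for some `n`. -/
def ipFilter : Filter (Finset ℕ) := ⨅ n : ℕ, 𝓟 {α | α.Nonempty ∧ ∀ i ∈ α, n ≤ i}

theorem hasBasis_ipFilter : ipFilter.HasBasis (fun _ : ℕ => True)
    fun n => {α | α.Nonempty ∧ ∀ i ∈ α, n ≤ i} := by
  refine hasBasis_iInf_principal (directed_of_isDirected_le fun m n hmn α hα => ?_)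
  exact ⟨hα.1, fun i hi => hmn.trans (hα.2 i hi)⟩

theorem eventually_ipFilter {p : Finset ℕ → Prop} : (∀ᶠ α in ipFilter, p α) ↔
    ∃ n : ℕ, ∀ α : Finset ℕ, α.Nonempty → (∀ i ∈ α, n ≤ i) → p α := by
  simp [hasBasis_ipFilter.eventually_iff]

theorem tendsto_singleton_ipFilter : Tendsto (fun n : ℕ => ({n} : Finset ℕ)) atTop ipFilter :=
  hasBasis_ipFilter.tendsto_right_iff.2 fun n _ => by
    filter_upwards [eventually_ge_atTop n] with m hm
    simpa using hm

instance : ipFilter.NeBot := tendsto_singleton_ipFilter.neBot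

theorem eventually_disjoint_ipFilter (β : Finset ℕ) : ∀ᶠ α in ipFilter, Disjoint β α := by
  refine eventually_ipFilter.2 ⟨β.sup id + 1, fun α _ hα =>
    Finset.disjoint_left.2 fun i hi hi' => ?_⟩
  have h1 := hα i hi'
  have h2 : i ≤ β.sup id := Finset.le_sup (f := id) hi
  omega

theorem eventually_nonempty_ipFilter : ∀ᶠ α in ipFilter, α.Nonempty :=
  eventually_ipFilter.2 ⟨0, fun _ h _ => h⟩

theorem tendsto_union_ipFilter :
    Tendsto (fun p : Finset ℕ × Finset ℕ => p.2 ∪ p.1) (ipFilter ×ˢ ipFilter) ipFilter := by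
  refine hasBasis_ipFilter.tendsto_right_iff.2 fun n _ => ?_
  have h := hasBasis_ipFilter.mem_of_mem (i := n) trivial
  filter_upwards [prod_mem_prod h h] with p hp
  refine ⟨hp.2.1.mono Finset.subset_union_left, fun i hi => ?_⟩
  rcases Finset.mem_union.1 hi with hi | hi
  exacts [hp.2.2 i hi, hp.1.2 i hi]

theorem isIPLimit_iff_tendsto {X : Type*} [TopologicalSpace X] {v : Finset ℕ → X} {x : X} :
    IsIPLimit v x ↔ Tendsto v ipFilter (𝓝 x) := by
  refine forall₂_congr fun U _ => ?_
  rw [mem_map, ← eventually_mem_set]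
  rw [eventually_ipFilter]
  constructor
  · rintro ⟨α₀, -, h⟩
    refine ⟨α₀.sup id + 1, fun α hα hn => h α hα fun i hi j hj => ?_⟩
    have h1 := hn j hj
    have h2 : i ≤ α₀.sup id := Finset.le_sup (f := id) hi
    omega
  · rintro ⟨n, h⟩
    exact ⟨{n}, by simp, fun α hα hn => h α hα fun i hi => (hn n (by simp) i hi).le⟩

variable {𝕜 : Type*} [RCLike 𝕜] {H : Type*} [NormedAddCommGroup H] [InnerProductSpace 𝕜 H]

theorem norm_le_of_tendsto_inner {v : Finset ℕ → H} {x : H} {C : ℝ}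
    (hv : ∀ y, Tendsto (fun α => ⟪y, v α⟫_𝕜) ipFilter (𝓝 ⟪y, x⟫_𝕜)) (hC : ∀ α, ‖v α‖ ≤ C) :
    ‖x‖ ≤ C := by
  have h := le_of_tendsto (hv x).norm (Eventually.of_forall fun α =>
    (norm_inner_le_norm (𝕜 := 𝕜) x (v α)).trans
      (mul_le_mul_of_nonneg_left (hC α) (norm_nonneg x)))
  rw [inner_self_eq_norm_sq_to_K, norm_pow, RCLike.norm_ofReal, abs_norm, sq] at h
  rcases (norm_nonneg x).eq_or_lt with h0 | h0
  · rw [← h0]; exact (norm_nonneg _).trans (hC ∅)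
  · exact le_of_mul_le_mul_left h h0

/-! ### Almost orthogonal vectors and the van der Corput lemma -/

/-- If `c` is, up to small errors, the inner product of `y` with each of arbitrarily many bounded
and almost orthogonal vectors, then `c = 0`: the average of `N` such vectors has norm
`O(N ^ (-1/2))`. -/
theorem eq_zero_of_almost_orthogonal (y : H) (c : 𝕜) (C : ℝ)
    (h : ∀ ε > 0, ∀ N : ℕ, ∃ x : ℕ → H, (∀ i < N, ‖x i‖ ≤ C) ∧
      (∀ i < N, ∀ j < N, i ≠ j → ‖⟪x i, x j⟫_𝕜‖ ≤ ε) ∧ ∀ i < N, ‖⟪y, x i⟫_𝕜 - c‖ ≤ ε) :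
    c = 0 := by
  have norm_inner_self : ∀ v : H, ‖⟪v, v⟫_𝕜‖ = ‖v‖ ^ 2 := fun v => by
    rw [inner_self_eq_norm_sq_to_K, norm_pow, RCLike.norm_ofReal, abs_norm]
  have key : ∀ N : ℕ, 0 < N → ‖c‖ * √N ≤ 1 + ‖y‖ * √(C ^ 2 + 1) := by
    intro N hN
    have hN' : (0 : ℝ) < N := by exact_mod_cast hN
    obtain ⟨x, hx, hxx, hxy⟩ := h (1 / N) (by positivity) N
    set s := ∑ i ∈ Finset.range N, x i with hs
    have h1 : ‖s‖ ^ 2 ≤ N * (C ^ 2 + 1) := by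
      rw [← norm_inner_self, hs, sum_inner]
      refine (norm_sum_le _ _).trans ?_
      have h2 : ∀ i ∈ Finset.range N,
          ‖⟪x i, ∑ j ∈ Finset.range N, x j⟫_𝕜‖ ≤ C ^ 2 + 1 := by
        intro i hi
        rw [inner_sum, ← Finset.add_sum_erase _ _ hi]
        have hi' := Finset.mem_range.1 hi
        refine (norm_add_le _ _).trans (add_le_add ?_ ?_)
        · rw [norm_inner_self]
          exact pow_le_pow_left₀ (norm_nonneg _) (hx i hi') 2
        · refine (norm_sum_le _ _).trans ?_
          calc ∑ j ∈ (Finset.range N).erase i, ‖⟪x i, x j⟫_𝕜‖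
              ≤ ∑ j ∈ (Finset.range N).erase i, (1 / N : ℝ) := by
                refine Finset.sum_le_sum fun j hj => ?_
                rw [Finset.mem_erase, Finset.mem_range] at hj
                exact hxx i hi' j hj.2 hj.1.symm
            _ ≤ ∑ j ∈ Finset.range N, (1 / N : ℝ) :=
                Finset.sum_le_sum_of_subset_of_nonneg (Finset.erase_subset _ _)
                  fun _ _ _ => by positivity
            _ = 1 := by simp [hN'.ne']
      calc ∑ i ∈ Finset.range N, ‖⟪x i, ∑ j ∈ Finset.range N, x j⟫_𝕜‖
          ≤ ∑ i ∈ Finset.range N, (C ^ 2 + 1) := Finset.sum_le_sum h2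
        _ = N * (C ^ 2 + 1) := by rw [Finset.sum_const, Finset.card_range, nsmul_eq_mul]
    have h2 : ‖s‖ ≤ √N * √(C ^ 2 + 1) := by
      rw [← Real.sqrt_mul hN'.le]
      exact Real.le_sqrt_of_sq_le h1
    have h3 : ‖⟪y, s⟫_𝕜 - N * c‖ ≤ 1 := by
      have : ⟪y, s⟫_𝕜 - N * c = ∑ i ∈ Finset.range N, (⟪y, x i⟫_𝕜 - c) := by
        rw [hs, inner_sum, Finset.sum_sub_distrib]; simp
      rw [this]
      refine (norm_sum_le _ _).trans ?_
      calc ∑ i ∈ Finset.range N, ‖⟪y, x i⟫_𝕜 - c‖ ≤ ∑ i ∈ Finset.range N, (1 / N : ℝ) :=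
            Finset.sum_le_sum fun i hi => hxy i (Finset.mem_range.1 hi)
        _ = 1 := by simp [hN'.ne']
    have h4 : N * ‖c‖ ≤ 1 + ‖y‖ * (√N * √(C ^ 2 + 1)) := by
      have h5 : ‖(N : 𝕜) * c‖ = N * ‖c‖ := by simp
      have h6 := norm_sub_norm_le ((N : 𝕜) * c) ⟪y, s⟫_𝕜
      rw [norm_sub_rev, h5] at h6
      have h7 := norm_inner_le_norm (𝕜 := 𝕜) y s
      have h8 := mul_le_mul_of_nonneg_left h2 (norm_nonneg y)
      linarith
    have h9 : 1 ≤ √(N : ℝ) := Real.one_le_sqrt.2 (by exact_mod_cast hN)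
    have h10 : √(N : ℝ) * √N = N := Real.mul_self_sqrt hN'.le
    refine le_of_mul_le_mul_right ?_ (zero_lt_one.trans_le h9)
    calc ‖c‖ * √N * √N = N * ‖c‖ := by rw [mul_assoc, h10, mul_comm]
      _ ≤ 1 + ‖y‖ * (√N * √(C ^ 2 + 1)) := h4
      _ ≤ √N + ‖y‖ * (√N * √(C ^ 2 + 1)) := by gcongr
      _ = (1 + ‖y‖ * √(C ^ 2 + 1)) * √N := by ring
  by_contra hc
  have hc' : 0 < ‖c‖ := norm_pos_iff.2 hc
  have ht : Tendsto (fun N : ℕ => ‖c‖ * √(N : ℝ)) atTop atTop :=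
    (Real.tendsto_sqrt_atTop.comp tendsto_natCast_atTop_atTop).const_mul_atTop hc'
  obtain ⟨N, hN, hN'⟩ := ((ht.eventually_gt_atTop _).and (eventually_gt_atTop 0)).exists
  exact absurd (key N hN') (not_le.2 hN)

/-- The van der Corput lemma for IP-limits. Along a rapidly increasing sequence `n₀ < n₁ < ⋯` the
vectors `w {nᵢ, …, n_{N-1}}`, `i < N`, are almost orthogonal, and all are weakly close to `z`. -/
theorem eq_zero_of_tendsto_inner_union {w : Finset ℕ → H} {z : H} (C : ℝ) (hC : ∀ α, ‖w α‖ ≤ C)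
    (hz : Tendsto (fun α => ⟪z, w α⟫_𝕜) ipFilter (𝓝 ⟪z, z⟫_𝕜))
    (hw : ∀ᶠ β in ipFilter, Tendsto (fun α => ⟪w (α ∪ β), w α⟫_𝕜) ipFilter (𝓝 0)) : z = 0 := by
  rw [← inner_self_eq_zero (𝕜 := 𝕜)]
  refine eq_zero_of_almost_orthogonal z _ C fun ε hε N => ?_
  have hz' : ∀ᶠ α in ipFilter, ‖⟪z, w α⟫_𝕜 - ⟪z, z⟫_𝕜‖ ≤ ε := by
    filter_upwards [hz.eventually (Metric.closedBall_mem_nhds _ hε)] with α hα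
    rwa [← dist_eq_norm]
  obtain ⟨a, ha⟩ := eventually_ipFilter.1 (hw.and hz')
  have hB : ∀ β : Finset ℕ, ∃ b : ℕ, β.Nonempty → (∀ i ∈ β, a ≤ i) → ∀ α : Finset ℕ, α.Nonempty →
      (∀ i ∈ α, b ≤ i) → ‖⟪w (α ∪ β), w α⟫_𝕜‖ ≤ ε := by
    intro β
    by_cases hβ : β.Nonempty ∧ ∀ i ∈ β, a ≤ i
    · have h := (ha β hβ.1 hβ.2).1
      have h' : ∀ᶠ α in ipFilter, ‖⟪w (α ∪ β), w α⟫_𝕜‖ ≤ ε := by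
        filter_upwards [h.eventually (Metric.closedBall_mem_nhds _ hε)] with α hα
        rwa [← sub_zero ⟪w (α ∪ β), w α⟫_𝕜, ← dist_eq_norm]
      obtain ⟨b, hb⟩ := eventually_ipFilter.1 h'
      exact ⟨b, fun _ _ => hb⟩
    · exact ⟨0, fun h1 h2 => absurd ⟨h1, h2⟩ hβ⟩
  choose b hb using hB
  let M : ℕ → ℕ := fun n => (Finset.range n).powerset.sup b
  let n : ℕ → ℕ := fun j => Nat.rec a (fun _ m => max (m + 1) (M (m + 1))) j
  have hn_succ : ∀ j, n (j + 1) = max (n j + 1) (M (n j + 1)) := fun _ => rfl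
  have hn : StrictMono n := strictMono_nat_of_lt_succ fun j => by
    rw [hn_succ]; exact (Nat.lt_succ_self _).trans_le (le_max_left _ _)
  have hna : ∀ j, a ≤ n j := fun j => hn.monotone (Nat.zero_le j)
  have hmem : ∀ {s : Finset ℕ} {i : ℕ}, i ∈ s.image n → a ≤ i := by
    intro s i hi
    obtain ⟨j, -, rfl⟩ := Finset.mem_image.1 hi
    exact hna j
  have hne : ∀ {i j : ℕ}, i < j → ((Finset.Ico i j).image n).Nonempty := fun hij =>
    (Finset.nonempty_Ico.2 hij).image n
  have main : ∀ i j, i < j → j < N →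
      ‖⟪w ((Finset.Ico i N).image n), w ((Finset.Ico j N).image n)⟫_𝕜‖ ≤ ε := by
    intro i j hij hj
    have hu : (Finset.Ico i N).image n = (Finset.Ico j N).image n ∪ (Finset.Ico i j).image n := by
      rw [← Finset.image_union, Finset.union_comm, Finset.Ico_union_Ico_eq_Ico hij.le hj.le]
    rw [hu]
    refine hb _ (hne hij) (fun _ => hmem) _ (hne hj) fun k hk => ?_
    obtain ⟨j', hj', rfl⟩ := Finset.mem_image.1 hk
    obtain ⟨p, rfl⟩ : ∃ p, j = p + 1 := ⟨j - 1, by omega⟩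
    calc b ((Finset.Ico i (p + 1)).image n) ≤ M (n p + 1) := by
          refine Finset.le_sup (f := b) (Finset.mem_powerset.2 fun x hx => ?_)
          obtain ⟨q, hq, rfl⟩ := Finset.mem_image.1 hx
          rw [Finset.mem_Ico] at hq
          exact Finset.mem_range.2 (Nat.lt_succ_of_le (hn.monotone (by omega)))
      _ ≤ n (p + 1) := le_max_right _ _
      _ ≤ n j' := hn.monotone (Finset.mem_Ico.1 hj').1
  refine ⟨fun i => w ((Finset.Ico i N).image n), fun i _ => hC _, fun i hi j hj hij => ?_,
    fun i hi => (ha _ (hne hi) fun _ => hmem).2⟩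
  rcases lt_or_gt_of_ne hij with h | h
  · exact main i j h hj
  · rw [norm_inner_symm]; exact main j i h hi

/-! ### Weak limits of a group of unitary families -/

variable {𝕜 : Type*} [RCLike 𝕜] {H : Type*} [NormedAddCommGroup H] [InnerProductSpace 𝕜 H]
variable {A : Type*} [Group A]

/-- `P a` is the IP-limit of `u a α` in the weak operator topology, for every `a`. -/
def HasWeakIPLimits (u : A →* (Finset ℕ → H ≃ₗᵢ[𝕜] H)) (P : A → H →L[𝕜] H) : Prop :=
  ∀ a f y, Tendsto (fun α => ⟪y, u a α f⟫_𝕜) ipFilter (𝓝 ⟪y, P a f⟫_𝕜)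

/-- The joint eigenspace of the projections `P l`, `l ∈ K`, on which `P l` is the identity for
`l ∈ L` and is `0` for `l ∈ K \ L`. -/
def jointEigenspace (P : A → H →L[𝕜] H) (K L : Subgroup A) : Submodule 𝕜 H where
  carrier := {f | ∀ l ∈ K, (l ∈ L → P l f = f) ∧ (l ∉ L → P l f = 0)}
  zero_mem' l _ := by simp
  add_mem' hf hg l hl := ⟨fun h => by rw [map_add, (hf l hl).1 h, (hg l hl).1 h],
    fun h => by rw [map_add, (hf l hl).2 h, (hg l hl).2 h, add_zero]⟩
  smul_mem' c f hf l hl := ⟨fun h => by rw [map_smul, (hf l hl).1 h],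
    fun h => by rw [map_smul, (hf l hl).2 h, smul_zero]⟩

namespace HasWeakIPLimits

variable {u : A →* (Finset ℕ → H ≃ₗᵢ[𝕜] H)} {P : A → H →L[𝕜] H} (hP : HasWeakIPLimits u P)
include hP

theorem apply_eq_of_tendsto {a : A} {f z : H}
    (h : ∀ y, Tendsto (fun α => ⟪y, u a α f⟫_𝕜) ipFilter (𝓝 ⟪y, z⟫_𝕜)) : P a f = z :=
  ext_inner_left 𝕜 fun y => tendsto_nhds_unique (hP a f y) (h y)

theorem norm_apply_le (a : A) (f : H) : ‖P a f‖ ≤ ‖f‖ :=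
  norm_le_of_tendsto_inner (hP a f) fun _ => (LinearIsometryEquiv.norm_map _ _).le

theorem fixed_iff_tendsto {a : A} {f : H} :
    P a f = f ↔ Tendsto (fun α => u a α f) ipFilter (𝓝 f) := by
  constructor
  · intro h
    have h1 := hP a f f
    rw [h] at h1
    rw [tendsto_iff_norm_sub_tendsto_zero]
    have h2 : ∀ α, ‖u a α f - f‖ = √(2 * ‖f‖ ^ 2 - 2 * RCLike.re ⟪f, u a α f⟫_𝕜) := by
      intro α
      rw [← Real.sqrt_sq (norm_nonneg (u a α f - f)), @norm_sub_sq 𝕜, inner_re_symm,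
        LinearIsometryEquiv.norm_map]
      ring_nf
    simp_rw [h2]
    have h3 := ((((RCLike.continuous_re (K := 𝕜)).tendsto _).comp h1).const_mul 2).const_sub
      (2 * ‖f‖ ^ 2)
    have h4 := (Real.continuous_sqrt.tendsto _).comp h3
    simpa [Function.comp_def] using h4
  · exact fun h => hP.apply_eq_of_tendsto fun y => tendsto_const_nhds.inner h

theorem tendsto_inner_of_tendsto (a : A) {w : Finset ℕ → H} {f : H}
    (hw : Tendsto w ipFilter (𝓝 f)) (y : H) :
    Tendsto (fun α => ⟪y, u a α (w α)⟫_𝕜) ipFilter (𝓝 ⟪y, P a f⟫_𝕜) := by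
  have h1 : Tendsto (fun α => ⟪y, u a α (w α - f)⟫_𝕜) ipFilter (𝓝 0) := by
    refine squeeze_zero_norm (a := fun α => ‖y‖ * ‖w α - f‖) (fun α => ?_) ?_
    · exact (norm_inner_le_norm _ _).trans_eq (by rw [LinearIsometryEquiv.norm_map])
    · simpa using (tendsto_iff_norm_sub_tendsto_zero.1 hw).const_mul ‖y‖
  have h2 := h1.add (hP a f y)
  simpa [map_sub, inner_sub_right] using h2

theorem mul_apply_of_fixed (a : A) {b : A} {f : H} (h : P b f = f) : P (a * b) f = P a f :=
  hP.apply_eq_of_tendsto fun y => by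
    simpa using hP.tendsto_inner_of_tendsto a (hP.fixed_iff_tendsto.1 h) y

/-- The elements `a` for which `u a α f` tends to `f` form a subgroup. -/
def fixingSubgroup (f : H) : Subgroup A where
  carrier := {a | P a f = f}
  one_mem' := hP.fixed_iff_tendsto.2 (by simp)
  mul_mem' {a b} ha hb := (hP.mul_apply_of_fixed a hb).trans ha
  inv_mem' {a} ha := by
    have h := hP.mul_apply_of_fixed a⁻¹ ha
    rw [inv_mul_cancel] at h
    exact h.symm.trans (hP.fixed_iff_tendsto.2 (by simp))

theorem mem_fixingSubgroup {a : A} {f : H} : a ∈ hP.fixingSubgroup f ↔ P a f = f := Iff.rfl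

/-- If `a` fixes `v` and `b` fixes `w` in the limit, then `⟪v, w⟫` is the limit of
`⟪u a α v, u b α w⟫ = ⟪v, u (a⁻¹ * b) α w⟫`. -/
theorem inner_eq_of_fixed {a b : A} {v w : H} (hv : P a v = v) (hw : P b w = w) :
    ⟪v, w⟫_𝕜 = ⟪v, P (a⁻¹ * b) w⟫_𝕜 := by
  refine tendsto_nhds_unique ?_ (hP (a⁻¹ * b) w v)
  refine ((hP.fixed_iff_tendsto.1 hv).inner (hP.fixed_iff_tendsto.1 hw)).congr fun α => ?_
  rw [← (u a α).inner_map_map v, map_mul, map_inv, Pi.mul_apply, Pi.inv_apply,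
    LinearIsometryEquiv.coe_mul, Function.comp_apply]
  congr 1
  exact ((u a α).apply_symm_apply _).symm

variable [CompleteSpace H]

theorem adjoint_eq (a : A) : ContinuousLinearMap.adjoint (P a) = P a⁻¹ := by
  refine ContinuousLinearMap.ext fun f => (hP.apply_eq_of_tendsto fun y => ?_).symm
  have h := (RCLike.continuous_conj.tendsto _).comp (hP a y f)
  simp only [Function.comp_def, inner_conj_symm] at h
  rw [ContinuousLinearMap.adjoint_inner_right]
  refine h.congr fun α => ?_
  rw [← (u a α).inner_map_map y, map_inv, Pi.inv_apply]
  congr 1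
  exact ((u a α).apply_symm_apply _).symm

/-- An idempotent weak limit is self-adjoint, because its adjoint is the weak limit for the inverse,
which fixes every vector of its range. -/
theorem isStarProjection_of_idem {a : A} (h : ∀ f, P a (P a f) = P a f) :
    IsStarProjection (P a) := by
  have h1 : ContinuousLinearMap.adjoint (P a) * P a = P a := by
    ext f
    rw [mul_apply_eq_comp, hP.adjoint_eq]
    exact inv_mem (hP.mem_fixingSubgroup.2 (h f))
  refine ⟨ContinuousLinearMap.ext h, ?_⟩
  rw [← h1]
  exact IsSelfAdjoint.star_mul_self (P a)

/-- The joint eigenspaces of commuting projections `P l`, `l ∈ K`, span a dense subspace. A nonzero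
vector orthogonal to all of them whose fixing subgroup is maximal would itself lie in one of them:
each `P l` that does not fix it sends it to a vector fixed by a larger subgroup. -/
theorem topologicalClosure_iSup_jointEigenspace [WellFoundedGT (Subgroup A)] {K : Subgroup A}
    (hproj : ∀ l ∈ K, IsStarProjection (P l)) (hcomm : ∀ k ∈ K, ∀ l ∈ K, Commute (P k) (P l)) :
    (⨆ L, jointEigenspace P K L).topologicalClosure = ⊤ := by
  rw [Submodule.topologicalClosure_eq_top_iff, Submodule.eq_bot_iff]
  by_contra! hne
  set S := ⨆ L, jointEigenspace P K L with hS
  obtain ⟨f₀, hf₀, hf₀'⟩ := hne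
  obtain ⟨M, ⟨f, hf, hf', hM⟩, hmax⟩ := WellFounded.has_min (wellFounded_gt (α := Subgroup A))
    {M | ∃ f ∈ Sᗮ, f ≠ 0 ∧ M = hP.fixingSubgroup f ⊓ K} ⟨_, f₀, hf₀, hf₀', rfl⟩
  -- `Sᗮ` is invariant because `P l` is self-adjoint and maps each joint eigenspace to itself
  have hinv : ∀ l ∈ K, P l f ∈ Sᗮ := by
    intro l hl
    rw [hS, ← Submodule.iInf_orthogonal, Submodule.mem_iInf]
    intro L v hv
    have hfv : ⟪v, f⟫_𝕜 = 0 := hf v (Submodule.mem_iSup_of_mem L hv)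
    rw [← ContinuousLinearMap.adjoint_inner_left,
      (ContinuousLinearMap.isSelfAdjoint_iff'.1 (hproj l hl).isSelfAdjoint)]
    by_cases hlL : l ∈ L
    · rw [(hv l hl).1 hlL, hfv]
    · rw [(hv l hl).2 hlL, inner_zero_left]
  have hfM : f ∈ jointEigenspace P K M := by
    intro l hl
    refine ⟨fun h => ?_, fun h => ?_⟩
    · rw [hM] at h; exact h.1
    · by_contra h0
      refine hmax _ ⟨P l f, hinv l hl, h0, rfl⟩ (SetLike.lt_iff_le_and_exists.2 ⟨?_, l, ?_, h⟩)
      · rw [hM]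
        intro k hk
        refine ⟨?_, hk.2⟩
        have hc := DFunLike.congr_fun (hcomm k hk.2 l hl).eq f
        rw [mul_apply_eq_comp, mul_apply_eq_comp,
          hP.mem_fixingSubgroup.1 hk.1] at hc
        exact hc
      · exact ⟨DFunLike.congr_fun (hproj l hl).isIdempotentElem f, hl⟩
  exact hf' (inner_self_eq_zero.1 (hf f (Submodule.mem_iSup_of_mem M hfM)))

theorem ext_jointEigenspace [WellFoundedGT (Subgroup A)] {K : Subgroup A}
    (hproj : ∀ l ∈ K, IsStarProjection (P l)) (hcomm : ∀ k ∈ K, ∀ l ∈ K, Commute (P k) (P l))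
    {S T : H →L[𝕜] H} (h : ∀ L, ∀ f ∈ jointEigenspace P K L, S f = T f) : S = T := by
  have hker : (⨆ L, jointEigenspace P K L).topologicalClosure ≤ (S - T).ker := by
    refine Submodule.topologicalClosure_minimal _ (iSup_le fun L f hf => ?_)
      (S - T).isClosed_ker
    simp [h L f hf]
  rw [hP.topologicalClosure_iSup_jointEigenspace hproj hcomm] at hker
  ext f
  have := hker (Submodule.mem_top (x := f))
  simpa [sub_eq_zero] using this

/-! ### Idempotence and commutation -/

/-- If the derivatives of `g` lie in `K`, then `P g` is idempotent on each joint eigenspace of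
`K`. Either arbitrarily late derivatives fix `f`, and the limit of `u g (α ∪ β) f` is computed in
two ways; or eventually all derivatives annihilate `f`, and the van der Corput lemma gives
`P g f = 0`. -/
theorem idem_of_mem_jointEigenspace {K L : Subgroup A} {g : A}
    (hg : ∀ᶠ β in ipFilter, ∃ h ∈ K, ∀ᶠ α in ipFilter,
      u g (α ∪ β) = u g α * u g β * u h α) {f : H} (hf : f ∈ jointEigenspace P K L) :
    P g (P g f) = P g f := by
  by_cases hL : ∃ᶠ β in ipFilter, ∃ h ∈ K, h ∈ L ∧ ∀ᶠ α in ipFilter,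
      u g (α ∪ β) = u g α * u g β * u h α
  · refine ext_inner_left 𝕜 fun y => ?_
    have h1 : Tendsto (fun β => ⟪y, P g (u g β f)⟫_𝕜) ipFilter (𝓝 ⟪y, P g (P g f)⟫_𝕜) := by
      have h2 := hP g f (ContinuousLinearMap.adjoint (P g) y)
      simpa only [ContinuousLinearMap.adjoint_inner_left] using h2
    refine eq_of_forall_dist_le fun ε hε => ?_
    have h2 := (hP g f y).comp tendsto_union_ipFilter
    have h3 := (h2.eventually (Metric.closedBall_mem_nhds _ (half_pos hε))).curry
    obtain ⟨β, ⟨⟨h, hK, hhL, hα⟩, hβ3⟩, hβ1⟩ := ((hL.and_eventually h3).and_eventually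
      (h1.eventually (Metric.closedBall_mem_nhds _ (half_pos hε)))).exists
    have h4 : Tendsto (fun α => ⟪y, u g (α ∪ β) f⟫_𝕜) ipFilter (𝓝 ⟪y, P g (u g β f)⟫_𝕜) := by
      have h5 := (((u g β).continuous.tendsto _).comp
        (hP.fixed_iff_tendsto.1 ((hf h hK).1 hhL)))
      refine (hP.tendsto_inner_of_tendsto g h5 y).congr' ?_
      filter_upwards [hα] with α hα
      rw [hα]; rfl
    have h6 := Metric.isClosed_closedBall.mem_of_tendsto h4 hβ3
    rw [dist_comm] at hβ1
    have := dist_triangle ⟪y, P g (P g f)⟫_𝕜 ⟪y, P g (u g β f)⟫_𝕜 ⟪y, P g f⟫_𝕜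
    have h7 : dist ⟪y, P g (u g β f)⟫_𝕜 ⟪y, P g f⟫_𝕜 ≤ ε / 2 := h6
    linarith
  · suffices P g f = 0 by rw [this, map_zero]
    refine eq_zero_of_tendsto_inner_union (𝕜 := 𝕜) (w := fun α => u g α f) ‖f‖
      (fun α => (LinearIsometryEquiv.norm_map _ _).le) (hP g f _) ?_
    filter_upwards [hg, not_frequently.1 hL] with β hβ hβL
    obtain ⟨h, hK, hα⟩ := hβ
    have h0 : P h f = 0 := (hf h hK).2 fun hh => hβL ⟨h, hK, hh, hα⟩
    have h1 := (RCLike.continuous_conj.tendsto _).comp (hP h f ((u g β).symm f))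
    rw [h0, inner_zero_right, map_zero] at h1
    refine h1.congr' ?_
    filter_upwards [hα] with α hα
    have h2 : ⟪u g α (u g β (u h α f)), u g α f⟫_𝕜 = ⟪u h α f, (u g β).symm f⟫_𝕜 := by
      rw [LinearIsometryEquiv.inner_map_map, ← (u g β).inner_map_map (u h α f),
        LinearIsometryEquiv.apply_symm_apply]
    rw [hα, Function.comp_apply, inner_conj_symm]
    exact h2.symm

/-- If `k` commutes with the values of `g` up to elements `e β ∈ K`, and the projection `P g`
commutes with all `P l`, `l ∈ K`, then `P k` maps the part of each joint eigenspace of `K` fixed by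
`P g` into the range of `P g`. -/
theorem apply_apply_of_mem_jointEigenspace {K L : Subgroup A} {g k : A}
    (hproj : ∀ a ∈ K ⊔ Subgroup.zpowers k, IsStarProjection (P a))
    (hgproj : IsStarProjection (P g))
    (hcomm : ∀ a ∈ K ⊔ Subgroup.zpowers k, ∀ l ∈ K, Commute (P a) (P l))
    (hk : ∀ β, ∃ e ∈ K, ∀ᶠ α in ipFilter, u k α * u g β = u g β * u k α * u e α)
    {f : H} (hf : f ∈ jointEigenspace P K L) (hgf : P g f = f) :
    P g (P k f) = P k f := by
  choose e heK he using hk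
  -- the conjugates `k * c n` of `k` by the values of `g` on the sets `{n}`
  set c : ℕ → A := fun n => e {n} with hc
  have hcK : ∀ n, c n ∈ K := fun n => heK _
  have hkc : ∀ n, k * c n ∈ K ⊔ Subgroup.zpowers k := fun n =>
    mul_mem (Subgroup.mem_sup_right (Subgroup.mem_zpowers k)) (Subgroup.mem_sup_left (hcK n))
  have hPkc : ∀ n v, P k (u g {n} v) = u g {n} (P (k * c n) v) := by
    intro n v
    refine hP.apply_eq_of_tendsto fun y => ?_
    have h1 := hP (k * c n) v ((u g {n}).symm y)
    rw [← (u g {n}).inner_map_map, LinearIsometryEquiv.apply_symm_apply] at h1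
    refine h1.congr' ?_
    filter_upwards [he {n}] with α hα
    rw [← (u g {n}).inner_map_map, LinearIsometryEquiv.apply_symm_apply, map_mul]
    exact congrArg _ (DFunLike.congr_fun hα v).symm
  have hgf' := (hP.fixed_iff_tendsto.1 hgf).comp tendsto_singleton_ipFilter
  have hlim : Tendsto (fun n => P k (u g {n} f)) atTop (𝓝 (P k f)) :=
    ((P k).continuous.tendsto f).comp hgf'
  by_cases hfreq : ∃ m, ∃ᶠ n in atTop, (c m)⁻¹ * c n ∈ L
  · obtain ⟨m, hm⟩ := hfreq
    set v := P (k * c m) f with hv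
    have hv' : ∀ n, (c m)⁻¹ * c n ∈ L → P k (u g {n} f) = u g {n} v := by
      intro n hn
      have h1 := (hf _ (mul_mem (inv_mem (hcK m)) (hcK n))).1 hn
      rw [hPkc, hv, ← hP.mul_apply_of_fixed (k * c m) h1]
      congr 3
      group
    have hgv : P g v = P k f := by
      refine ext_inner_left 𝕜 fun y => ?_
      refine tendsto_nhds_unique_of_frequently_eq ((hP g v y).comp tendsto_singleton_ipFilter)
        (tendsto_const_nhds.inner hlim) (hm.mono fun n hn => ?_)
      rw [hv' n hn]; rfl
    rw [← hgv]
    exact DFunLike.congr_fun hgproj.isIdempotentElem v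
  · -- otherwise `P k f` is a limit of vectors `u g {n} w` with `w` ranging over an orthogonal family
    push Not at hfreq
    suffices P k f = 0 by rw [this, map_zero]
    have hidem : ∀ n, P (k * c n) (P (k * c n) f) = P (k * c n) f := fun n =>
      DFunLike.congr_fun (hproj _ (hkc n)).isIdempotentElem f
    have horth : ∀ m n, (c m)⁻¹ * c n ∉ L → ⟪P (k * c m) f, P (k * c n) f⟫_𝕜 = 0 := by
      intro m n hmn
      have hl : (c m)⁻¹ * c n ∈ K := mul_mem (inv_mem (hcK m)) (hcK n)
      rw [hP.inner_eq_of_fixed (hidem m) (hidem n)]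
      have h1 : (k * c m)⁻¹ * (k * c n) = (c m)⁻¹ * c n := by group
      have h2 := DFunLike.congr_fun (hcomm _ (hkc n) _ hl).eq f
      rw [mul_apply_eq_comp, mul_apply_eq_comp, (hf _ hl).2 hmn, map_zero] at h2
      rw [h1, ← h2, inner_zero_right]
    have hinner : ∀ n, ⟪f, P (k * c n) f⟫_𝕜 = ⟪P k (u g {n} f), P k (u g {n} f)⟫_𝕜 := by
      intro n
      rw [hPkc, LinearIsometryEquiv.inner_map_map]
      conv_lhs => rw [← hidem n]
      rw [← ContinuousLinearMap.adjoint_inner_left,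
        ContinuousLinearMap.isSelfAdjoint_iff'.1 (hproj _ (hkc n)).isSelfAdjoint]
    rw [← inner_self_eq_zero (𝕜 := 𝕜)]
    refine eq_zero_of_almost_orthogonal f _ ‖f‖ fun ε hε N => ?_
    have hev := (hlim.inner (𝕜 := 𝕜) hlim).eventually (Metric.closedBall_mem_nhds _ hε)
    obtain ⟨φ, hφ, hφφ⟩ := exists_seq_of_forall_finset_exists
      (fun n => dist ⟪P k (u g {n} f), P k (u g {n} f)⟫_𝕜 ⟪P k f, P k f⟫_𝕜 ≤ ε)
      (fun m n => (c m)⁻¹ * c n ∉ L) fun s _ => (hev.and ((Filter.eventually_all_finset s).2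
        fun m _ => hfreq m)).exists
    refine ⟨fun i => P (k * c (φ i)) f, fun i _ => hP.norm_apply_le _ _, fun i _ j _ hij => ?_,
      fun i _ => ?_⟩
    · refine (norm_eq_zero.2 ?_).trans_le hε.le
      rcases lt_or_gt_of_ne hij with h | h
      · exact horth _ _ (hφφ i j h)
      · exact inner_eq_zero_symm.1 (horth _ _ (hφφ j i h))
    · rw [hinner, ← dist_eq_norm]; exact hφ i

/-- The Hilbert space part of the theorem. The group `A` carries a decreasing sequence of subgroups
`B i`, eventually acting trivially, such that derivatives of elements of `B i`, and commutators of
elements of `B i` with values of elements of `A`, belong to `B (i + 1)`. -/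
theorem isStarProjection_and_commute [WellFoundedGT (Subgroup A)] {B : ℕ → Subgroup A}
    (hB : Antitone B) {d : ℕ} (hd : ∀ l ∈ B d, ∀ᶠ α in ipFilter, u l α = 1)
    (hderiv : ∀ i, ∀ g ∈ B i, ∀ᶠ β in ipFilter, ∃ h ∈ B (i + 1), ∀ᶠ α in ipFilter,
      u g (α ∪ β) = u g α * u g β * u h α)
    (hcommutator : ∀ i, ∀ g, ∀ k ∈ B i, ∀ β, ∃ e ∈ B (i + 1), ∀ᶠ α in ipFilter,
      u k α * u g β = u g β * u k α * u e α) (m : ℕ) :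
    (∀ g ∈ B m, IsStarProjection (P g)) ∧ ∀ g ∈ B m, ∀ k ∈ B m, Commute (P g) (P k) := by
  have hone : ∀ l ∈ B d, P l = 1 := fun l hl => ContinuousLinearMap.ext fun f =>
    hP.apply_eq_of_tendsto fun y => tendsto_const_nhds.congr' <| by
      filter_upwards [hd l hl] with α hα
      rw [hα]; rfl
  by_cases hmd : d ≤ m
  · have hone' : ∀ l ∈ B m, P l = 1 := fun l hl => hone l (hB hmd hl)
    refine ⟨fun g hg => ?_, fun g hg k hk => ?_⟩
    · rw [hone' g hg]; exact IsStarProjection.one _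
    · rw [hone' g hg]; exact Commute.one_left _
  obtain ⟨hproj, hcomm⟩ := isStarProjection_and_commute hB hd hderiv hcommutator (m + 1)
  have hproj' : ∀ g ∈ B m, IsStarProjection (P g) := by
    intro g hg
    refine hP.isStarProjection_of_idem fun f => ?_
    have h : P g * P g = P g := hP.ext_jointEigenspace hproj hcomm fun L f hf =>
      hP.idem_of_mem_jointEigenspace (hderiv m g hg) hf
    exact DFunLike.congr_fun h f
  refine ⟨hproj', ?_⟩
  have main : ∀ n i, d ≤ i + n → m ≤ i → ∀ g ∈ B m, ∀ k ∈ B i, Commute (P g) (P k) := by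
    intro n
    induction n with
    | zero =>
      intro i hi _ g _ k hk
      rw [hone k (hB (by omega) hk)]; exact Commute.one_right _
    | succ n ih =>
      intro i hi hmi g hg k hk
      have ih' := ih (i + 1) (by omega) (by omega)
      have hle : B (i + 1) ⊔ Subgroup.zpowers k ≤ B m :=
        sup_le (hB (by omega)) (by simpa using hB hmi hk)
      have hPg := hproj' g hg
      have hPk := hproj' k (hB hmi hk)
      have hK : ∀ l ∈ B (i + 1), l ∈ B m := fun l hl => hB (by omega) hl
      have h : P g * P k * P g = P k * P g := by
        refine hP.ext_jointEigenspace (K := B (i + 1)) (fun l hl => hproj' l (hK l hl))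
          (fun a ha l hl => ih' a (hK a ha) l hl) fun L f hf => ?_
        have hf' : P g f ∈ jointEigenspace P (B (i + 1)) L := by
          intro l hl
          have hc := DFunLike.congr_fun (ih' g hg l hl).eq f
          rw [mul_apply_eq_comp, mul_apply_eq_comp] at hc
          refine ⟨fun h => ?_, fun h => ?_⟩
          · rw [← hc, (hf l hl).1 h]
          · rw [← hc, (hf l hl).2 h, map_zero]
        exact hP.apply_apply_of_mem_jointEigenspace (fun a ha => hproj' a (hle ha)) hPg
          (fun a ha l hl => ih' a (hle ha) l hl) (hcommutator i g k hk) hf'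
          (DFunLike.congr_fun hPg.isIdempotentElem f)
      -- the adjoint of the identity `P g * P k * P g = P k * P g`
      have h' := congrArg star h
      rw [star_mul, star_mul, star_mul, hPg.isSelfAdjoint.star_eq, hPk.isSelfAdjoint.star_eq,
        ← mul_assoc, h] at h'
      exact h'.symm
  exact fun g hg k hk => main d m (by omega) le_rfl g hg k hk
termination_by d - m

end HasWeakIPLimits

/-! ### The filtration of a VIP group -/

namespace Prefiltration

variable {Γ : Type*} [Group Γ] {G : Prefiltration Γ}

namespace IsPolynomialAt

variable {d : ℕ} (hd : G.grp d = ⊥) {i : ℕ} {g : Finset ℕ → Γ}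
include hd

/-- If `c` lies in `G 1`, then the commutator of `g` with the constant map `c` gains one level. -/
theorem commutator_const (hg : G.IsPolynomialAt i g) {c : Γ} (hc : c ∈ G.grp 1) :
    G.IsPolynomialAt (i + 1) fun α => ⁅g α, c⁆ :=
  commutator hd hg (const hd hc)

theorem conj_const (hg : G.IsPolynomialAt i g) {c : Γ} (hc : c ∈ G.grp 0) :
    G.IsPolynomialAt i fun α => c⁻¹ * g α * c := by
  have h := mul hd (commutator hd (const hd (inv_mem hc)) hg) (mono hd (by omega) hg)
  rw [zero_add] at h
  convert h using 1
  funext α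
  simp [commutatorElement_def]

end IsPolynomialAt

/-- The elements of `F` that agree, on the sets disjoint from some finite set, with a
`G[+i]`-polynomial map. Since the values of symmetric derivatives are prescribed only on disjoint
sets, this and not the subgroup of `G[+i]`-polynomial elements of `F` is stable under
taking symmetric derivatives; IP-limits do not distinguish the two. -/
def eventualSubgroup {d : ℕ} (hd : G.grp d = ⊥) (F : Subgroup (Finset ℕ → Γ)) (i : ℕ) :
    Subgroup F where
  carrier := {g | ∃ p α₀, G.IsPolynomialAt i p ∧ ∀ β, Disjoint α₀ β → (g : Finset ℕ → Γ) β = p β}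
  one_mem' := ⟨1, ∅, .one hd i, fun _ _ => rfl⟩
  mul_mem' := by
    rintro g h ⟨p, α₀, hp, hgp⟩ ⟨q, β₀, hq, hhq⟩
    refine ⟨p * q, α₀ ∪ β₀, hp.mul hd hq, fun β hβ => ?_⟩
    rw [Finset.disjoint_union_left] at hβ
    simp [hgp β hβ.1, hhq β hβ.2]
  inv_mem' := by
    rintro g ⟨p, α₀, hp, hgp⟩
    exact ⟨p⁻¹, α₀, hp.inv hd, fun β hβ => by simp [hgp β hβ]⟩

section

variable {d : ℕ} (hd : G.grp d = ⊥) {F : Subgroup (Finset ℕ → Γ)}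

theorem antitone_eventualSubgroup : Antitone (eventualSubgroup hd F) := by
  rintro i j hij g ⟨p, α₀, hp, hgp⟩
  exact ⟨p, α₀, hp.mono hd hij, hgp⟩

theorem eventually_eq_one_of_mem_eventualSubgroup {g : F} (hg : g ∈ eventualSubgroup hd F d) :
    ∀ᶠ α in ipFilter, (g : Finset ℕ → Γ) α = 1 := by
  obtain ⟨p, α₀, hp, hgp⟩ := hg
  filter_upwards [eventually_disjoint_ipFilter α₀] with α hα
  rw [hgp α hα, hp.eq_one_of_le hd le_rfl, Pi.one_apply]

namespace IsVIPGroup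

variable (hF : G.IsVIPGroup F)
include hF

theorem eventualSubgroup_zero_eq_top : eventualSubgroup hd F 0 = ⊤ :=
  top_unique fun g _ => ⟨g, ∅, (hF.isVIP g g.2).1, fun _ _ => rfl⟩

theorem apply_mem_grp_one {g : Finset ℕ → Γ} (hg : g ∈ F) (α : Finset ℕ) : g α ∈ G.grp 1 :=
  IsPolynomialAt.mem_grp_succ (i := 0) (hF.isVIP g hg).1 (hF.isVIP g hg).2 α

/-- The derivative `(g β)⁻¹ * (g α)⁻¹ * g (α ∪ β)` is the symmetric derivative of `g` conjugated by
the constant `g β`. -/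
theorem eventually_exists_deriv {i : ℕ} {g : F} (hg : g ∈ eventualSubgroup hd F i) :
    ∀ᶠ β in ipFilter, ∃ h ∈ eventualSubgroup hd F (i + 1), ∀ᶠ α in ipFilter,
      (g : Finset ℕ → Γ) (α ∪ β) =
        (g : Finset ℕ → Γ) α * (g : Finset ℕ → Γ) β * (h : Finset ℕ → Γ) α := by
  obtain ⟨p, α₀, hp, hgp⟩ := hg
  filter_upwards [eventually_nonempty_ipFilter, eventually_disjoint_ipFilter α₀] with β hβ hβα
  obtain ⟨s, hsF, -, hs⟩ := hF.symmDeriv_mem g g.2 β hβ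
  set c : Γ := (g : Finset ℕ → Γ) β with hc
  have hp0 : p ∅ = 1 := by
    rw [← hgp ∅ (Finset.disjoint_empty_right _)]; exact (hF.isVIP g g.2).2
  have hcp : c ∈ G.grp (i + 1) := by
    rw [hc, hgp β hβα]; exact hp.mem_grp_succ hp0 β
  have hc0 : c ∈ G.grp 0 := G.antitone' (Nat.zero_le _) hcp
  obtain ⟨D, hD, hDp⟩ := (IsPolynomialAt.iff_exists_deriv.1 hp).2 β
  refine ⟨⟨fun α => c⁻¹ * s α * c, hF.conj_mem s hsF c hc0⟩, ?_, ?_⟩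
  · refine ⟨fun α => c⁻¹ * (D α * c⁻¹) * c, α₀ ∪ β,
      (hD.mul hd (.const hd (inv_mem hcp))).conj_const hd hc0, fun α hα => ?_⟩
    rw [Finset.disjoint_union_left] at hα
    have h1 : (g : Finset ℕ → Γ) (β ∪ α) = p (β ∪ α) :=
      hgp _ (Finset.disjoint_union_right.2 ⟨hβα, hα.1⟩)
    change c⁻¹ * s α * c = c⁻¹ * (D α * c⁻¹) * c
    rw [hs α hα.2, h1, hDp α hα.2, hgp α hα.1]
    group
  · filter_upwards [eventually_disjoint_ipFilter β] with α hα
    rw [hs α hα, Finset.union_comm]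
    group

theorem exists_commutator {i : ℕ} (g : F) {k : F} (hk : k ∈ eventualSubgroup hd F i)
    (β : Finset ℕ) : ∃ e ∈ eventualSubgroup hd F (i + 1), ∀ α,
      (k : Finset ℕ → Γ) α * (g : Finset ℕ → Γ) β =
        (g : Finset ℕ → Γ) β * (k : Finset ℕ → Γ) α * (e : Finset ℕ → Γ) α := by
  set c : Γ := (g : Finset ℕ → Γ) β with hc
  have hc1 : c ∈ G.grp 1 := hF.apply_mem_grp_one g.2 β
  have hc0 : c ∈ G.grp 0 := G.antitone' (Nat.zero_le _) hc1
  obtain ⟨p, α₀, hp, hkp⟩ := hk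
  refine ⟨k⁻¹ * ⟨_, hF.conj_mem k k.2 c hc0⟩, ⟨_, α₀,
    (hp.inv hd).commutator_const hd (inv_mem hc1), fun α hα => ?_⟩, fun α => ?_⟩
  · simp [commutatorElement_def, hkp α hα, mul_assoc]
  · simp [mul_assoc]

include hd in
/-- All elements of `F` take values in the nilpotent group `G 1`. -/
theorem exists_lowerCentralSeries_eq_bot :
    ∃ n, (⊤ : Subgroup F).lowerCentralSeries n = ⊥ := by
  have h : ∀ n, ∀ g ∈ (⊤ : Subgroup F).lowerCentralSeries n, ∀ α,
      (g : Finset ℕ → Γ) α ∈ G.grp (n + 1) := by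
    intro n
    induction n with
    | zero => exact fun g _ α => hF.apply_mem_grp_one g.2 α
    | succ n ih =>
      let K : Subgroup F := ⨅ α, (G.grp (n + 2)).comap ((Pi.evalMonoidHom _ α).comp F.subtype)
      have hK : (⊤ : Subgroup F).lowerCentralSeries (n + 1) ≤ K := by
        refine Subgroup.commutator_le.2 fun x hx y _ => Subgroup.mem_iInf.2 fun α => ?_
        exact G.commutator_le' (n + 1) 1
          (Subgroup.commutator_mem_commutator (ih x hx α) (hF.apply_mem_grp_one y.2 α))
      exact fun g hg α => Subgroup.mem_iInf.1 (hK hg) α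
  refine ⟨d, (Subgroup.eq_bot_iff_forall _).2 fun g hg => Subtype.ext (funext fun α => ?_)⟩
  have := G.antitone' (Nat.le_succ d) (h d g hg α)
  rwa [hd, Subgroup.mem_bot] at this

end IsVIPGroup

end

end Prefiltration

/-! ### Weak limits as operators -/

section WeakTopology

variable {𝕜 : Type*} [RCLike 𝕜] {H : Type*} [NormedAddCommGroup H] [InnerProductSpace 𝕜 H]

theorem IsWeakIPLimit.tendsto_inner {v : Finset ℕ → H} {x : H} (h : IsWeakIPLimit 𝕜 v x) (y : H) :
    Tendsto (fun α => ⟪y, v α⟫_𝕜) ipFilter (𝓝 ⟪y, x⟫_𝕜) :=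
  ((WeakBilin.eval_continuous (topDualPairing 𝕜 H).flip (innerSL 𝕜 y)).tendsto _).comp
    (isIPLimit_iff_tendsto.1 h)

/-- Weak IP-limits of isometries, applied pointwise, form a bounded linear operator. -/
theorem exists_clm_of_isWeakIPLimit {T : Finset ℕ → H ≃ₗᵢ[𝕜] H} {P : H → H}
    (h : ∀ f, IsWeakIPLimit 𝕜 (fun α => T α f) (P f)) : ∃ Q : H →L[𝕜] H, ∀ f, Q f = P f := by
  have unique : ∀ {f z : H}, (∀ y, Tendsto (fun α => ⟪y, T α f⟫_𝕜) ipFilter (𝓝 ⟪y, z⟫_𝕜)) →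
      P f = z := fun {f z} hz => ext_inner_left 𝕜 fun y =>
    tendsto_nhds_unique ((h f).tendsto_inner y) (hz y)
  let Q : H →ₗ[𝕜] H :=
    { toFun := P
      map_add' := fun f g => unique fun y => by
        simpa [inner_add_right] using ((h f).tendsto_inner y).add ((h g).tendsto_inner y)
      map_smul' := fun c f => unique fun y => by
        simpa [inner_smul_right] using ((h f).tendsto_inner y).const_mul c }
  refine ⟨Q.mkContinuous 1 fun f => ?_, fun f => rfl⟩
  rw [one_mul]
  exact norm_le_of_tendsto_inner (h f).tendsto_inner fun α => (LinearIsometryEquiv.norm_map _ _).le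

end WeakTopology

end FVIP

/-! ### Weak limits along an FVIP group -/

open FVIP FVIP.Prefiltration in
theorem mainTheorem10 {𝕜 : Type*} [RCLike 𝕜]
    {H : Type*} [NormedAddCommGroup H] [InnerProductSpace 𝕜 H] [CompleteSpace H]
    {Γ : Type*} [Group Γ] (G : FVIP.Prefiltration Γ) (hG0 : G.grp 0 = ⊤)
    (hG : G.HasFiniteLength)
    (π : Γ →* unitary (H →L[𝕜] H))
    (F : Subgroup (Finset ℕ → Γ)) (hF : G.IsFVIPGroup F)
    (P : (Finset ℕ → Γ) → H → H)
    (hP : ∀ g ∈ F, ∀ f : H,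
      FVIP.IsWeakIPLimit 𝕜 (fun α => (π (g α) : H →L[𝕜] H) f) (P g f)) :
    (∀ g ∈ F, FVIP.IsOrthogonalProjection 𝕜 (P g)) ∧
      ∀ g ∈ F, ∀ h ∈ F, ∀ f : H, P g (P h f) = P h (P g f) := by
  obtain ⟨d, hd⟩ := hG
  obtain ⟨hV, hfg⟩ := hF
  let U : Γ →* (H ≃ₗᵢ[𝕜] H) := Unitary.linearIsometryEquiv.toMonoidHom.comp π
  let u : F →* (Finset ℕ → H ≃ₗᵢ[𝕜] H) := (MonoidHom.compLeft U (Finset ℕ)).comp F.subtype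
  choose Q hQ using fun g : F => exists_clm_of_isWeakIPLimit (T := u g) (hP g g.2)
  have hlim : HasWeakIPLimits u Q := by
    intro g f y
    rw [hQ]
    exact (hP g g.2 f).tendsto_inner y
  have : Group.FG F := (Group.fg_iff_subgroup_fg F).2 hfg
  obtain ⟨n, hn⟩ := hV.exists_lowerCentralSeries_eq_bot hd
  have := wellFoundedGT_subgroup_of_lowerCentralSeries_eq_bot n F hn
  have htop : ∀ g : F, g ∈ eventualSubgroup hd F 0 := fun g => by
    rw [hV.eventualSubgroup_zero_eq_top hd]; trivial
  obtain ⟨hproj, hcomm⟩ := hlim.isStarProjection_and_commute (antitone_eventualSubgroup hd)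
    (fun l hl => (eventually_eq_one_of_mem_eventualSubgroup hd hl).mono fun α hα => by
      change U ((l : Finset ℕ → Γ) α) = 1
      rw [hα, map_one])
    (fun i g hg => (hV.eventually_exists_deriv hd hg).mono fun β ⟨h, hh, hα⟩ =>
      ⟨h, hh, hα.mono fun α hα => by
        change U ((g : Finset ℕ → Γ) (α ∪ β)) = _
        rw [hα, map_mul, map_mul]; rfl⟩)
    (fun i g k hk β => by
      obtain ⟨e, he, heq⟩ := hV.exists_commutator hd g hk β
      refine ⟨e, he, Eventually.of_forall fun α => ?_⟩
      have h := congrArg U (heq α)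
      rw [map_mul, map_mul, map_mul] at h
      exact h) 0
  refine ⟨fun g hg => ?_, fun g hg h hh f => ?_⟩
  · obtain ⟨K, hK, hQK⟩ := isStarProjection_iff_eq_starProjection.1 (hproj ⟨g, hg⟩ (htop _))
    exact ⟨K, hK, fun f => by rw [← hQ ⟨g, hg⟩, hQK]⟩
  · have h1 := DFunLike.congr_fun (hcomm ⟨g, hg⟩ (htop _) ⟨h, hh⟩ (htop _)).eq f
    rw [mul_apply_eq_comp, mul_apply_eq_comp] at h1
    simpa only [hQ] using h1
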